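/- Let $g,n\ge 1$ be integers and $N=2gn$. Let $|\varphi_2\rangle = 2^{-n/2}\sum_{j=0}^n \sqrt{\binom nj}\,|D^{N}_{gj}\rangle$ be the $N$-qubit probe state, where $|D^N_w\rangle=\binom Nw^{-1/2}\sum_{x\in\{0,1\}^N,\ x_1+\dots+x_N=w}|x_1\rangle\otimes\dots\otimes|x_N\rangle$ is the Dicke state of weight $w$. For $p\in[0,1]$ let $$\sigma=\sum_{j=0}^N p^j(1-p)^{N-j}\sum_{x\in\{0,1\}^N,\ x_1+\dots+x_N=j} Z_x|\varphi_2\rangle\langle\varphi_2|Z_x,\qquad Z_x=Z^{x_1}\otimes\dots\otimes Z^{x_N},$$ be the state after i.i.d. dephasing in which every qubit independently suffers a Pauli $Z$ error with probability $p$. Let $Q_g$ be the quantum Fisher information of $\sigma$ with respect to the generator $H=\sum_{j=1}^N Z_j$, where for a density matrix $\rho$ with spectral decomposition $\rho=\sum_i\lambda_i|e_i\rangle\langle e_i|$ it is $2\sum_{i,j:\ \lambda_i+\lambda_j\ne0}\frac{(\lambda_i-\lambda_j)^2}{\lambda_i+\lambda_j}|\langle e_i|H|e_j\rangle|^2$.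 Fix $n\ge1$ and an expected number $t\ge0$ of dephasing errors, and put $p=t/N$ (so $p\le 1$ for all large $g$). Then $$\liminf_{g\to\infty}\frac{Q_g}{N^2}\ \ge\ \frac{e^{-2t}}{2n}-2te ,$$ where $e$ is Euler's number. Consequently Heisenberg scaling is retained for a small number of dephasing errors: for every $n\ge1$ there are $t_0>0$ and $c>0$ such that for every $t\in[0,t_0]$ one has $Q_g\ge cN^2$ for all sufficiently large $g$. -/

import Mathlib

open scoped Matrix

noncomputable section

namespace GnuMetrology

/-- The computational basis of `N` qubits: bit strings of length `N`. State vectors are functions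
`Bits N → ℂ`, operators are matrices indexed by `Bits N`. -/
abbrev Bits (N : ℕ) : Type := Fin N → Fin 2

/-- The number of ones in a bit string. -/
def weight {N : ℕ} (x : Bits N) : ℕ := ∑ i, (x i : ℕ)

/-- The Dicke state `|D^N_w⟩`: the normalized sum of all basis vectors of weight `w`. -/
def dicke (N w : ℕ) : Bits N → ℂ := fun x =>
  if weight x = w then ((1 / Real.sqrt (N.choose w) : ℝ) : ℂ) else 0

/-- The gnu probe state `|φ_u⟩ = 2^{-n/2} ∑_{j=0}^n √(n choose j) |D^{gnu}_{gj}⟩`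
on `N = gnu` qubits. -/
def gnuProbe (g n u : ℕ) : Bits (g * n * u) → ℂ :=
  ((Real.sqrt ((2 ^ n)⁻¹) : ℝ) : ℂ) •
    ∑ j ∈ Finset.range (n + 1),
      ((Real.sqrt (n.choose j) : ℝ) : ℂ) • dicke (g * n * u) (g * j)

/-- The rank-one operator `|ψ⟩⟨ψ|`. -/
def ketbra {N : ℕ} (ψ : Bits N → ℂ) : Matrix (Bits N) (Bits N) ℂ :=
  Matrix.vecMulVec ψ (star ψ)

/-- The Pauli operator `Z_j`, acting as `Z` on qubit `j` and trivially elsewhere: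
`Z_j |y⟩ = (-1)^{y_j} |y⟩`. -/
def pauliZ (N : ℕ) (j : Fin N) : Matrix (Bits N) (Bits N) ℂ :=
  Matrix.diagonal fun y => (-1) ^ (y j : ℕ)

/-- `Z_x = Z^{x_1} ⊗ ⋯ ⊗ Z^{x_N}`, that is `Z_x |y⟩ = ∏ i, (-1)^{x_i y_i} |y⟩`. -/
def zString {N : ℕ} (x : Bits N) : Matrix (Bits N) (Bits N) ℂ :=
  Matrix.diagonal fun y => ∏ i, (-1) ^ ((x i : ℕ) * (y i : ℕ))

/-- The generator `H = ∑_j Z_j`. -/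
def generator (N : ℕ) : Matrix (Bits N) (Bits N) ℂ := ∑ j, pauliZ N j

/-- The i.i.d. dephasing channel on `N` qubits: independently on every qubit, a `Z` error occurs
with probability `p`. -/
def dephase {N : ℕ} (p : ℝ) (ρ : Matrix (Bits N) (Bits N) ℂ) : Matrix (Bits N) (Bits N) ℂ :=
  ∑ j ∈ Finset.range (N + 1), (p ^ j * (1 - p) ^ (N - j) : ℝ) •
    ∑ x : Bits N with weight x = j, zString x * ρ * zString x

/-- The dephased probe state `σ`, obtained from `|φ_2⟩` on `N = 2gn` qubits. -/
def dephasedProbe (g n : ℕ) (p : ℝ) : Matrix (Bits (g * n * 2)) (Bits (g * n * 2)) ℂ :=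
  dephase p (ketbra (gnuProbe g n 2))

theorem zString_isHermitian {N : ℕ} (x : Bits N) : (zString x).IsHermitian := by
  unfold zString
  rw [Matrix.isHermitian_diagonal_iff]
  intro y
  simp [isSelfAdjoint_iff]

theorem dephase_isHermitian {N : ℕ} (p : ℝ) {ρ : Matrix (Bits N) (Bits N) ℂ}
    (hρ : ρ.IsHermitian) : (dephase p ρ).IsHermitian := by
  have hterm : ∀ x : Bits N, IsSelfAdjoint (zString x * ρ * zString x) := by
    intro x
    have h := Matrix.isHermitian_conjTranspose_mul_mul (zString x) hρ
    rw [(zString_isHermitian x).eq] at h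
    exact h
  have hsum : ∀ j : ℕ, IsSelfAdjoint
      (∑ x : Bits N with weight x = j, zString x * ρ * zString x) := fun j =>
    isSelfAdjoint_sum _ fun x _ => hterm x
  exact isSelfAdjoint_sum _ fun j _ => IsSelfAdjoint.smul (IsSelfAdjoint.all _) (hsum j)

theorem dephasedProbe_isHermitian (g n : ℕ) (p : ℝ) : (dephasedProbe g n p).IsHermitian := by
  apply dephase_isHermitian
  ext a b
  simp [ketbra, Matrix.vecMulVec_apply, mul_comm]

/-- The quantum Fisher information of the state `ρ` with respect to the generator `H`, i.e. of the
family `χ ↦ e^{-iχH} ρ e^{iχH}`: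
`2 ∑_{i,j} (λ_i - λ_j)² / (λ_i + λ_j) |⟨e_i|H|e_j⟩|²`, the sum being over the pairs with
`λ_i + λ_j ≠ 0`, where `ρ = ∑_i λ_i |e_i⟩⟨e_i|` is a spectral decomposition. -/
def qfi {ι : Type*} [Fintype ι] [DecidableEq ι] (ρ H : Matrix ι ι ℂ) (hρ : ρ.IsHermitian) : ℝ :=
  2 * ∑ i, ∑ j,
    if hρ.eigenvalues i + hρ.eigenvalues j = 0 then 0 else
      (hρ.eigenvalues i - hρ.eigenvalues j) ^ 2 / (hρ.eigenvalues i + hρ.eigenvalues j) *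
        ‖star (⇑(hρ.eigenvectorBasis i)) ⬝ᵥ (H *ᵥ ⇑(hρ.eigenvectorBasis j))‖ ^ 2

/-- The quantum Fisher information of the dephased probe state `σ` with respect to
`H = ∑_j Z_j`. -/
def dephasedQFI (g n : ℕ) (p : ℝ) : ℝ :=
  qfi (dephasedProbe g n p) (generator (g * n * 2)) (dephasedProbe_isHermitian g n p)

end GnuMetrology

end

namespace GnuMetrology

open scoped ComplexOrder

/-! Cauchy–Schwarz in an eigenbasis of `ρ` bounds the quantum Fisher information below by any single
matrix element of the commutator `[ρ, H]` (`two_mul_norm_commutator_sq_le_qfi_mul`). Take `a` to be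
the noiseless probe `f` and `b = f * h`, where `h` is the deviation of `H` from its mean. For a pure
probe the matrix element is the variance `V` of `H`.

Dephasing averages over error patterns. The trivial pattern has probability `q = (1 - p) ^ N`; every
other pattern is replaced by its worst case. This yields `Q * (2 - q) ≥ 2 * V * (3 * q - 2) ^ 2`
(`two_mul_variance_mul_sq_le_qfi_dephase`).

For the gnu probe `V = g ^ 2 * n` is four times a binomial variance scaled by `g ^ 2`, and Bernoulli
gives `q ≥ 1 - t`. Hence `Q / N ^ 2 ≥ (1 - 7 * t) / (2 * n)` for `t ≤ 1 / 3` (`le_dephasedQFI`).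
This exceeds the claimed bound, which is negative for `t > 1 / 3`. -/

/-! ### Eigenbasis expansions and the variational bound. -/

theorem star_dotProduct_eq_sum_eigenvectorBasis {ι : Type*} [Fintype ι] [DecidableEq ι]
    {ρ : Matrix ι ι ℂ} (hρ : ρ.IsHermitian) (u v : ι → ℂ) :
    star u ⬝ᵥ v = ∑ i, (star u ⬝ᵥ ⇑(hρ.eigenvectorBasis i)) *
      (star (⇑(hρ.eigenvectorBasis i)) ⬝ᵥ v) := by
  have h := hρ.eigenvectorBasis.sum_inner_mul_inner (WithLp.toLp 2 u) (WithLp.toLp 2 v)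
  simp only [EuclideanSpace.inner_eq_star_dotProduct] at h
  rw [dotProduct_comm, ← h]
  refine Finset.sum_congr rfl fun i _ => ?_
  rw [dotProduct_comm (star u), dotProduct_comm (star (⇑(hρ.eigenvectorBasis i)))]

theorem star_eigenvectorBasis_dotProduct_mulVec {ι : Type*} [Fintype ι] [DecidableEq ι]
    {ρ : Matrix ι ι ℂ} (hρ : ρ.IsHermitian) (i : ι) (v : ι → ℂ) :
    star (⇑(hρ.eigenvectorBasis i)) ⬝ᵥ (ρ *ᵥ v) =
      hρ.eigenvalues i * (star (⇑(hρ.eigenvectorBasis i)) ⬝ᵥ v) := by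
  rw [Matrix.dotProduct_mulVec]
  have h : star (⇑(hρ.eigenvectorBasis i)) ᵥ* ρ = star (ρ *ᵥ ⇑(hρ.eigenvectorBasis i)) := by
    rw [Matrix.star_mulVec, hρ.eq]
  rw [h, hρ.mulVec_eigenvectorBasis, star_smul, smul_dotProduct]
  simp

theorem star_dotProduct_mulVec_eq_sum {ι : Type*} [Fintype ι] [DecidableEq ι]
    {ρ : Matrix ι ι ℂ} (hρ : ρ.IsHermitian) (H : Matrix ι ι ℂ) (a b : ι → ℂ) :
    star a ⬝ᵥ (H *ᵥ b) = ∑ i, ∑ j, (star a ⬝ᵥ ⇑(hρ.eigenvectorBasis i)) *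
      (star (⇑(hρ.eigenvectorBasis i)) ⬝ᵥ (H *ᵥ ⇑(hρ.eigenvectorBasis j))) *
      (star (⇑(hρ.eigenvectorBasis j)) ⬝ᵥ b) := by
  rw [star_dotProduct_eq_sum_eigenvectorBasis hρ a]
  refine Finset.sum_congr rfl fun i _ => ?_
  have h : ∀ v, star (⇑(hρ.eigenvectorBasis i)) ⬝ᵥ (H *ᵥ v) =
      star (Hᴴ *ᵥ ⇑(hρ.eigenvectorBasis i)) ⬝ᵥ v := by
    intro v
    rw [Matrix.dotProduct_mulVec, Matrix.star_mulVec, Matrix.conjTranspose_conjTranspose]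
  rw [h, star_dotProduct_eq_sum_eigenvectorBasis hρ (Hᴴ *ᵥ _), Finset.mul_sum]
  refine Finset.sum_congr rfl fun j _ => ?_
  rw [h, mul_assoc]

theorem star_dotProduct_self_eq_sum {ι : Type*} [Fintype ι] [DecidableEq ι]
    {ρ : Matrix ι ι ℂ} (hρ : ρ.IsHermitian) (a : ι → ℂ) :
    (star a ⬝ᵥ a).re = ∑ i, ‖star (⇑(hρ.eigenvectorBasis i)) ⬝ᵥ a‖ ^ 2 := by
  rw [star_dotProduct_eq_sum_eigenvectorBasis hρ, Complex.re_sum]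
  refine Finset.sum_congr rfl fun i _ => ?_
  rw [show star a ⬝ᵥ ⇑(hρ.eigenvectorBasis i) =
    star (star (⇑(hρ.eigenvectorBasis i)) ⬝ᵥ a) by rw [Matrix.star_dotProduct]]
  rw [Complex.star_def, mul_comm, Complex.mul_conj, Complex.normSq_eq_norm_sq]
  norm_cast

theorem star_dotProduct_mulVec_self_eq_sum {ι : Type*} [Fintype ι] [DecidableEq ι]
    {ρ : Matrix ι ι ℂ} (hρ : ρ.IsHermitian) (a : ι → ℂ) :
    (star a ⬝ᵥ (ρ *ᵥ a)).re =
      ∑ i, hρ.eigenvalues i * ‖star (⇑(hρ.eigenvectorBasis i)) ⬝ᵥ a‖ ^ 2 := by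
  rw [star_dotProduct_eq_sum_eigenvectorBasis hρ, Complex.re_sum]
  refine Finset.sum_congr rfl fun i _ => ?_
  rw [star_eigenvectorBasis_dotProduct_mulVec, show star a ⬝ᵥ ⇑(hρ.eigenvectorBasis i) =
    star (star (⇑(hρ.eigenvectorBasis i)) ⬝ᵥ a) by rw [Matrix.star_dotProduct]]
  rw [Complex.star_def, mul_left_comm, mul_comm (starRingEnd ℂ _), Complex.mul_conj,
    Complex.normSq_eq_norm_sq]
  norm_cast

theorem qfi_nonneg {ι : Type*} [Fintype ι] [DecidableEq ι] {ρ : Matrix ι ι ℂ}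
    (hρ : ρ.IsHermitian) (hpos : ρ.PosSemidef) (H : Matrix ι ι ℂ) : 0 ≤ qfi ρ H hρ := by
  unfold qfi
  refine mul_nonneg zero_le_two (Finset.sum_nonneg fun i _ => Finset.sum_nonneg fun j _ => ?_)
  split_ifs
  · exact le_rfl
  · have hi := hpos.eigenvalues_nonneg i
    have hj := hpos.eigenvalues_nonneg j
    positivity

/-- The variational lower bound on the quantum Fisher information, for the rank-one observable
`|b⟩⟨a|`. -/
theorem two_mul_norm_commutator_sq_le_qfi_mul {ι : Type*} [Fintype ι] [DecidableEq ι]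
    {ρ : Matrix ι ι ℂ} (hρ : ρ.IsHermitian) (hpos : ρ.PosSemidef) (H : Matrix ι ι ℂ)
    (a b : ι → ℂ) :
    2 * ‖star a ⬝ᵥ (ρ *ᵥ (H *ᵥ b)) - star a ⬝ᵥ (H *ᵥ (ρ *ᵥ b))‖ ^ 2 ≤
      qfi ρ H hρ * ((star a ⬝ᵥ (ρ *ᵥ a)).re * (star b ⬝ᵥ b).re +
        (star a ⬝ᵥ a).re * (star b ⬝ᵥ (ρ *ᵥ b)).re) := by
  set l := hρ.eigenvalues with hl
  set e : ι → ι → ℂ := fun i => ⇑(hρ.eigenvectorBasis i) with he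
  have hl0 : ∀ i, 0 ≤ l i := hpos.eigenvalues_nonneg
  set A : ι → ι → ℝ := fun i j => if l i + l j = 0 then 0 else
      (l i - l j) ^ 2 / (l i + l j) * ‖star (e i) ⬝ᵥ (H *ᵥ e j)‖ ^ 2 with hA
  set B : ι → ι → ℝ := fun i j =>
    (l i + l j) * (‖star (e i) ⬝ᵥ a‖ ^ 2 * ‖star (e j) ⬝ᵥ b‖ ^ 2) with hB
  set r : ι → ι → ℝ := fun i j => |l i - l j| * ‖star (e i) ⬝ᵥ (H *ᵥ e j)‖ *
    (‖star (e i) ⬝ᵥ a‖ * ‖star (e j) ⬝ᵥ b‖) with hr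
  have hA0 : ∀ i j, 0 ≤ A i j := by
    intro i j
    have := hl0 i
    have := hl0 j
    simp only [hA]
    split_ifs <;> positivity
  have hB0 : ∀ i j, 0 ≤ B i j := by
    intro i j
    have := hl0 i
    have := hl0 j
    simp only [hB]
    positivity
  have hAB : ∀ i j, r i j ^ 2 = A i j * B i j := by
    intro i j
    simp only [hA, hB, hr]
    split_ifs with h
    -- Nonnegative eigenvalues with zero sum both vanish, so the pairs omitted from the Fisher
    -- information contribute nothing to the commutator.
    · have h1 : l i - l j = 0 := by linarith [hl0 i, hl0 j]
      simp [h1]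
    · rw [mul_pow, mul_pow, mul_pow, sq_abs]
      field_simp
  have hcs : (∑ i, ∑ j, r i j) ^ 2 ≤ (∑ i, ∑ j, A i j) * ∑ i, ∑ j, B i j := by
    simp only [← Fintype.sum_prod_type']
    exact Finset.sum_sq_le_sum_mul_sum_of_sq_le_mul _ (fun x _ => hA0 x.1 x.2)
      (fun x _ => hB0 x.1 x.2) (fun x _ => (hAB x.1 x.2).le)
  have hstar : ∀ i, star a ⬝ᵥ e i = star (star (e i) ⬝ᵥ a) := fun i => by
    rw [Matrix.star_dotProduct]
  have hnorm : ‖star a ⬝ᵥ (ρ *ᵥ (H *ᵥ b)) - star a ⬝ᵥ (H *ᵥ (ρ *ᵥ b))‖ ≤ ∑ i, ∑ j, r i j := by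
    have h1 : star a ⬝ᵥ (ρ *ᵥ (H *ᵥ b)) = ∑ i, ∑ j, (l i : ℂ) * ((star a ⬝ᵥ e i) *
        (star (e i) ⬝ᵥ (H *ᵥ e j)) * (star (e j) ⬝ᵥ b)) := by
      rw [Matrix.mulVec_mulVec, star_dotProduct_mulVec_eq_sum hρ]
      refine Finset.sum_congr rfl fun i _ => Finset.sum_congr rfl fun j _ => ?_
      rw [← Matrix.mulVec_mulVec, star_eigenvectorBasis_dotProduct_mulVec]
      ring
    have h2 : star a ⬝ᵥ (H *ᵥ (ρ *ᵥ b)) = ∑ i, ∑ j, (l j : ℂ) * ((star a ⬝ᵥ e i) *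
        (star (e i) ⬝ᵥ (H *ᵥ e j)) * (star (e j) ⬝ᵥ b)) := by
      rw [star_dotProduct_mulVec_eq_sum hρ]
      refine Finset.sum_congr rfl fun i _ => Finset.sum_congr rfl fun j _ => ?_
      rw [star_eigenvectorBasis_dotProduct_mulVec]
      ring
    rw [h1, h2, ← Finset.sum_sub_distrib]
    refine (norm_sum_le _ _).trans (Finset.sum_le_sum fun i _ => ?_)
    rw [← Finset.sum_sub_distrib]
    refine (norm_sum_le _ _).trans (Finset.sum_le_sum fun j _ => le_of_eq ?_)
    rw [← sub_mul, ← Complex.ofReal_sub, norm_mul, norm_mul, norm_mul, hstar, norm_star,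
      Complex.norm_real, Real.norm_eq_abs]
    simp only [hr]
    ring
  have hBsum : ∑ i, ∑ j, B i j = (star a ⬝ᵥ (ρ *ᵥ a)).re * (star b ⬝ᵥ b).re +
        (star a ⬝ᵥ a).re * (star b ⬝ᵥ (ρ *ᵥ b)).re := by
    rw [star_dotProduct_mulVec_self_eq_sum hρ, star_dotProduct_mulVec_self_eq_sum hρ,
      star_dotProduct_self_eq_sum hρ, star_dotProduct_self_eq_sum hρ, Finset.sum_mul_sum,
      Finset.sum_mul_sum, ← Finset.sum_add_distrib]
    refine Finset.sum_congr rfl fun i _ => ?_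
    rw [← Finset.sum_add_distrib]
    refine Finset.sum_congr rfl fun j _ => ?_
    simp only [hB]
    ring
  have hq : qfi ρ H hρ = 2 * ∑ i, ∑ j, A i j := rfl
  rw [hq, ← hBsum, mul_assoc]
  have hpow := pow_le_pow_left₀ (norm_nonneg _) hnorm 2
  linarith

/-! ### Dephasing as an average over error patterns. -/

theorem weight_eq_card {N : ℕ} (x : Bits N) :
    weight x = (Finset.univ.filter fun i => x i = 1).card := by
  rw [weight, Finset.card_filter]
  refine Finset.sum_congr rfl fun i _ => ?_
  generalize x i = b
  fin_cases b <;> simp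

theorem card_weight_eq (N w : ℕ) :
    (Finset.univ.filter fun x : Bits N => weight x = w).card = N.choose w := by
  rw [show N.choose w = (Finset.powersetCard w (Finset.univ : Finset (Fin N))).card by simp]
  refine Finset.card_bij' (fun x _ => Finset.univ.filter fun i => x i = 1)
    (fun s _ i => if i ∈ s then 1 else 0) ?_ ?_ ?_ ?_
  · intro x hx
    simpa [Finset.mem_powersetCard, weight_eq_card] using hx
  · intro s hs
    simpa [Finset.mem_powersetCard, weight_eq_card] using hs
  · intro x _
    funext i
    simp only [Finset.mem_filter, Finset.mem_univ, true_and]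
    generalize x i = b
    fin_cases b <;> simp
  · intro s _
    ext i
    simp

theorem weight_le {N : ℕ} (x : Bits N) : weight x ≤ N := by
  rw [weight_eq_card]
  simpa using Finset.card_filter_le (Finset.univ : Finset (Fin N)) fun i => x i = 1

/-- The binomial theorem for `p + (1 - p)`, grouped by weight; valid for every real `p`. -/
theorem sum_weight_pow_mul_pow (N : ℕ) (p : ℝ) :
    ∑ x : Bits N, p ^ weight x * (1 - p) ^ (N - weight x) = 1 := by
  rw [← Finset.sum_fiberwise_of_maps_to (t := Finset.range (N + 1)) (g := weight)
    (fun x _ => Finset.mem_range.2 (Nat.lt_succ_of_le (weight_le x)))]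
  have h := add_pow p (1 - p) N
  rw [add_sub_cancel, one_pow] at h
  refine Eq.trans (Finset.sum_congr rfl fun j _ => ?_) h.symm
  rw [Finset.sum_congr rfl (g := fun _ => p ^ j * (1 - p) ^ (N - j)), Finset.sum_const,
    card_weight_eq, nsmul_eq_mul, mul_comm]
  intro x hx
  rw [(Finset.mem_filter.1 hx).2]

theorem dephase_eq_sum {N : ℕ} (p : ℝ) (ρ : Matrix (Bits N) (Bits N) ℂ) :
    dephase p ρ = ∑ x : Bits N, (p ^ weight x * (1 - p) ^ (N - weight x) : ℝ) •
      (zString x * ρ * zString x) := by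
  unfold dephase
  rw [← Finset.sum_fiberwise_of_maps_to (s := Finset.univ) (t := Finset.range (N + 1))
    (g := weight) (fun x _ => Finset.mem_range.2 (Nat.lt_succ_of_le (weight_le x)))]
  refine Finset.sum_congr rfl fun j _ => ?_
  rw [Finset.smul_sum]
  refine Finset.sum_congr rfl fun x hx => ?_
  rw [(Finset.mem_filter.1 hx).2]

theorem dephase_posSemidef {N : ℕ} {p : ℝ} (hp₀ : 0 ≤ p) (hp₁ : p ≤ 1)
    {ρ : Matrix (Bits N) (Bits N) ℂ} (hρ : ρ.PosSemidef) : (dephase p ρ).PosSemidef := by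
  rw [dephase_eq_sum]
  refine Matrix.posSemidef_sum _ fun x _ => Matrix.PosSemidef.smul ?_ ?_
  · have h := hρ.conjTranspose_mul_mul_same (zString x)
    rwa [(zString_isHermitian x).eq] at h
  · have : 0 ≤ 1 - p := sub_nonneg.2 hp₁
    positivity

/-- The diagonal entry `⟨y|Z_x|y⟩`. -/
noncomputable def zSign {N : ℕ} (x y : Bits N) : ℝ := ∏ i, (-1) ^ ((x i : ℕ) * (y i : ℕ))

theorem abs_zSign {N : ℕ} (x y : Bits N) : |zSign x y| = 1 := by
  simp [zSign, Finset.abs_prod]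

theorem zSign_zero {N : ℕ} (y : Bits N) : zSign 0 y = 1 := by
  simp [zSign]

theorem zString_mulVec_ofReal {N : ℕ} (x : Bits N) (u : Bits N → ℝ) :
    zString x *ᵥ (fun y => (u y : ℂ)) = fun y => ((zSign x y * u y : ℝ) : ℂ) := by
  funext y
  simp [zString, Matrix.mulVec_diagonal, zSign]

theorem star_dotProduct_ofReal {ι : Type*} [Fintype ι] (u v : ι → ℝ) :
    star (fun y => (u y : ℂ)) ⬝ᵥ (fun y => (v y : ℂ)) = ((∑ y, u y * v y : ℝ) : ℂ) := by
  simp [dotProduct]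

theorem star_dotProduct_dephase_ketbra_mulVec {N : ℕ} (p : ℝ) (f u v : Bits N → ℝ) :
    star (fun y => (u y : ℂ)) ⬝ᵥ
        (dephase p (ketbra fun y => (f y : ℂ)) *ᵥ fun y => (v y : ℂ)) =
      ((∑ x : Bits N, p ^ weight x * (1 - p) ^ (N - weight x) *
        ((∑ y, zSign x y * (u y * f y)) * ∑ y, zSign x y * (f y * v y)) : ℝ) : ℂ) := by
  rw [dephase_eq_sum, Matrix.sum_mulVec, dotProduct_sum, Complex.ofReal_sum]
  refine Finset.sum_congr rfl fun x _ => ?_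
  rw [Matrix.smul_mulVec, dotProduct_smul, Complex.real_smul, Complex.ofReal_mul,
    ← Matrix.mulVec_mulVec, ← Matrix.mulVec_mulVec, zString_mulVec_ofReal, ketbra,
    Matrix.vecMulVec_mulVec, star_dotProduct_ofReal, Matrix.mulVec_smul, zString_mulVec_ofReal,
    dotProduct_smul, star_dotProduct_ofReal]
  simp only [MulOpposite.smul_eq_mul_unop, MulOpposite.unop_op, Complex.ofReal_mul]
  congr 2
  · norm_cast
    refine Finset.sum_congr rfl fun y _ => by ring
  · norm_cast
    refine Finset.sum_congr rfl fun y _ => by ring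

theorem generator_eq_diagonal (N : ℕ) :
    generator N = Matrix.diagonal fun y => (((N : ℝ) - 2 * weight y : ℝ) : ℂ) := by
  ext y z
  rw [generator, Matrix.sum_apply]
  by_cases h : y = z
  · subst h
    simp only [pauliZ, Matrix.diagonal_apply_eq, weight]
    have hbit : ∀ i, ((-1 : ℂ)) ^ ((y i : Fin 2) : ℕ) = 1 - 2 * ((y i : ℕ) : ℂ) := by
      intro i
      generalize y i = b
      fin_cases b <;> norm_num
    simp only [hbit]
    push_cast
    rw [Finset.sum_sub_distrib, ← Finset.mul_sum]
    simp
  · simp [pauliZ, h]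

/-! ### Weight distribution of the gnu probe and binomial moments. -/

/-- The (real) amplitudes of the gnu probe state. -/
noncomputable def gnuAmplitude (g n u : ℕ) (y : Bits (g * n * u)) : ℝ :=
  Real.sqrt ((2 ^ n)⁻¹) * ∑ j ∈ Finset.range (n + 1), Real.sqrt (n.choose j) *
    if weight y = g * j then 1 / Real.sqrt ((g * n * u).choose (g * j)) else 0

theorem gnuProbe_eq_ofReal (g n u : ℕ) :
    gnuProbe g n u = fun y => (gnuAmplitude g n u y : ℂ) := by
  funext y
  simp [gnuProbe, gnuAmplitude, dicke, Finset.sum_apply, apply_ite Complex.ofReal]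

/-- For `g ≥ 1` the weights `g * j` are distinct, so no cross terms survive squaring; `u ≥ 1` keeps
them at most `N`, so each Dicke normalization cancels against the number of strings. All moments of
`H` thereby reduce to those of a fair binomial law. -/
theorem sum_gnuAmplitude_sq_mul {g u : ℕ} (n : ℕ) (hg : 1 ≤ g) (hu : 1 ≤ u) (F : ℕ → ℝ) :
    ∑ y, gnuAmplitude g n u y ^ 2 * F (weight y) =
      ∑ j ∈ Finset.range (n + 1), (2 ^ n)⁻¹ * (n.choose j : ℝ) * F (g * j) := by
  have hsq : ∀ y : Bits (g * n * u), gnuAmplitude g n u y ^ 2 * F (weight y) =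
      ∑ j ∈ Finset.range (n + 1), if weight y = g * j then
        (2 ^ n)⁻¹ * (n.choose j : ℝ) * F (g * j) / ((g * n * u).choose (g * j)) else 0 := by
    intro y
    by_cases hy : ∃ k ∈ Finset.range (n + 1), weight y = g * k
    · obtain ⟨k, hk, hyk⟩ := hy
      have hiff : ∀ j, weight y = g * j ↔ k = j := by
        intro j
        rw [hyk]
        exact Nat.mul_right_inj (by omega)
      simp only [gnuAmplitude, hiff, mul_ite, mul_zero, Finset.sum_ite_eq, hk, if_true]
      rw [hyk, mul_pow, mul_pow, div_pow, Real.sq_sqrt (by positivity),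
        Real.sq_sqrt (by positivity), Real.sq_sqrt (by positivity)]
      ring
    · push Not at hy
      rw [Finset.sum_eq_zero fun j hj => if_neg (hy j hj), gnuAmplitude,
        Finset.sum_eq_zero fun j hj => by rw [if_neg (hy j hj), mul_zero]]
      simp
  rw [Finset.sum_congr rfl fun y _ => hsq y, Finset.sum_comm]
  refine Finset.sum_congr rfl fun j hj => ?_
  rw [← Finset.sum_filter, Finset.sum_const, card_weight_eq, nsmul_eq_mul]
  have hjn : j ≤ n := Nat.lt_succ_iff.1 (Finset.mem_range.1 hj)
  have hle : g * j ≤ g * n * u :=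
    (Nat.mul_le_mul_left g hjn).trans (Nat.le_mul_of_pos_right _ hu)
  have hne : ((g * n * u).choose (g * j) : ℝ) ≠ 0 := by
    exact_mod_cast (Nat.choose_pos hle).ne'
  field_simp

theorem sum_half_binomial (n : ℕ) :
    ∑ j ∈ Finset.range (n + 1), (2 ^ n)⁻¹ * (n.choose j : ℝ) = 1 := by
  rw [← Finset.mul_sum, ← Nat.cast_sum, Nat.sum_range_choose]
  simp

theorem bernsteinPolynomial_eval_half {n j : ℕ} (hj : j ∈ Finset.range (n + 1)) :
    (bernsteinPolynomial ℝ n j).eval (1 / 2) = (2 ^ n)⁻¹ * (n.choose j : ℝ) := by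
  have hjn : j ≤ n := Nat.lt_succ_iff.1 (Finset.mem_range.1 hj)
  simp only [bernsteinPolynomial, Polynomial.eval_mul, Polynomial.eval_natCast,
    Polynomial.eval_pow, Polynomial.eval_X, Polynomial.eval_sub, Polynomial.eval_one]
  rw [show (1 - 1 / 2 : ℝ) = 1 / 2 by norm_num, mul_assoc, ← pow_add, Nat.add_sub_cancel' hjn]
  rw [one_div, inv_pow, mul_comm]

theorem sum_half_binomial_mul (n : ℕ) :
    ∑ j ∈ Finset.range (n + 1), (2 ^ n)⁻¹ * (n.choose j : ℝ) * j = (n : ℝ) / 2 := by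
  have h := congrArg (Polynomial.eval (1 / 2)) (bernsteinPolynomial.sum_smul ℝ n)
  rw [Polynomial.eval_finsetSum] at h
  simp only [nsmul_eq_mul, Polynomial.eval_mul, Polynomial.eval_natCast, Polynomial.eval_X] at h
  rw [show (n : ℝ) / 2 = n * (1 / 2) by ring, ← h]
  refine Finset.sum_congr rfl fun j hj => ?_
  rw [bernsteinPolynomial_eval_half hj, mul_comm]

theorem sum_half_binomial_mul_sq (n : ℕ) :
    ∑ j ∈ Finset.range (n + 1), (2 ^ n)⁻¹ * (n.choose j : ℝ) * ((n : ℝ) / 2 - j) ^ 2 = (n : ℝ) / 4 := by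
  have h := congrArg (Polynomial.eval (1 / 2)) (bernsteinPolynomial.variance ℝ n)
  rw [Polynomial.eval_finsetSum] at h
  simp only [nsmul_eq_mul, Polynomial.eval_mul, Polynomial.eval_natCast, Polynomial.eval_X,
    Polynomial.eval_sub, Polynomial.eval_pow, Polynomial.eval_one] at h
  rw [show (n : ℝ) / 4 = n * (1 / 2) * (1 - 1 / 2) by ring, ← h]
  refine Finset.sum_congr rfl fun j hj => ?_
  rw [bernsteinPolynomial_eval_half hj]
  ring

/-! ### Fisher information of a dephased real state. -/

theorem star_dotProduct_diagonal_ofReal_mulVec {ι : Type*} [Fintype ι] [DecidableEq ι]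
    (k u : ι → ℝ) (w : ι → ℂ) :
    star (fun y => (u y : ℂ)) ⬝ᵥ (Matrix.diagonal (fun y => (k y : ℂ)) *ᵥ w) =
      star (fun y => ((k y * u y : ℝ) : ℂ)) ⬝ᵥ w := by
  simp only [dotProduct, Matrix.mulVec_diagonal, Pi.star_apply, Complex.star_def,
    Complex.ofReal_mul, map_mul, Complex.conj_ofReal]
  exact Finset.sum_congr rfl fun y _ => by ring

theorem diagonal_ofReal_mulVec_ofReal {ι : Type*} [Fintype ι] [DecidableEq ι] (k u : ι → ℝ) :
    Matrix.diagonal (fun y => (k y : ℂ)) *ᵥ (fun y => (u y : ℂ)) =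
      fun y => ((k y * u y : ℝ) : ℂ) := by
  funext y
  simp [Matrix.mulVec_diagonal]

theorem abs_sum_zSign_mul_le {N : ℕ} (x : Bits N) {k : Bits N → ℝ} (hk : ∀ y, 0 ≤ k y) :
    |∑ y, zSign x y * k y| ≤ ∑ y, k y := by
  refine (Finset.abs_sum_le_sum_abs _ _).trans (Finset.sum_le_sum fun y _ => ?_)
  rw [abs_mul, abs_zSign, one_mul, abs_of_nonneg (hk y)]

/-- Cauchy–Schwarz with weights `f y ^ 2`; the signs disappear on squaring. -/
theorem sq_sum_zSign_mul_le {N : ℕ} (x : Bits N) (f h : Bits N → ℝ) :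
    (∑ y, zSign x y * (f y ^ 2 * h y)) ^ 2 ≤ (∑ y, f y ^ 2) * ∑ y, f y ^ 2 * h y ^ 2 := by
  refine Finset.sum_sq_le_sum_mul_sum_of_sq_le_mul _ (fun y _ => sq_nonneg _)
    (fun y _ => by positivity) fun y _ => le_of_eq ?_
  rw [mul_pow, ← sq_abs, abs_zSign]
  ring

/-- The commutator of the dephased state with a diagonal generator, evaluated between the probe
amplitude `f` and `f * h`. -/
theorem commutator_dephase_ketbra {N : ℕ} (p c : ℝ) (f h : Bits N → ℝ) :
    star (fun y => (f y : ℂ)) ⬝ᵥ (dephase p (ketbra fun y => (f y : ℂ)) *ᵥ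
        (Matrix.diagonal (fun y => ((h y + c : ℝ) : ℂ)) *ᵥ fun y => ((f y * h y : ℝ) : ℂ))) -
      star (fun y => (f y : ℂ)) ⬝ᵥ (Matrix.diagonal (fun y => ((h y + c : ℝ) : ℂ)) *ᵥ
        (dephase p (ketbra fun y => (f y : ℂ)) *ᵥ fun y => ((f y * h y : ℝ) : ℂ))) =
    ((∑ x : Bits N, p ^ weight x * (1 - p) ^ (N - weight x) *
      ((∑ y, zSign x y * f y ^ 2) * (∑ y, zSign x y * (f y ^ 2 * h y ^ 2)) -
        (∑ y, zSign x y * (f y ^ 2 * h y)) ^ 2) : ℝ) : ℂ) := by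
  rw [diagonal_ofReal_mulVec_ofReal, star_dotProduct_diagonal_ofReal_mulVec,
    star_dotProduct_dephase_ketbra_mulVec, star_dotProduct_dephase_ketbra_mulVec,
    ← Complex.ofReal_sub, ← Finset.sum_sub_distrib]
  congr 1
  refine Finset.sum_congr rfl fun x _ => ?_
  have h0 : ∑ y, zSign x y * (f y * f y) = ∑ y, zSign x y * f y ^ 2 :=
    Finset.sum_congr rfl fun y _ => by ring
  have h1 : ∑ y, zSign x y * (f y * (f y * h y)) = ∑ y, zSign x y * (f y ^ 2 * h y) :=
    Finset.sum_congr rfl fun y _ => by ring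
  -- The shift `c` adds the same product to both halves of the commutator, so it cancels.
  have h2 : ∑ y, zSign x y * (f y * ((h y + c) * (f y * h y))) =
      ∑ y, zSign x y * (f y ^ 2 * h y ^ 2) + c * ∑ y, zSign x y * (f y ^ 2 * h y) := by
    rw [Finset.mul_sum, ← Finset.sum_add_distrib]
    exact Finset.sum_congr rfl fun y _ => by ring
  have h3 : ∑ y, zSign x y * ((h y + c) * f y * f y) =
      ∑ y, zSign x y * (f y ^ 2 * h y) + c * ∑ y, zSign x y * f y ^ 2 := by
    rw [Finset.mul_sum, ← Finset.sum_add_distrib]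
    exact Finset.sum_congr rfl fun y _ => by ring
  rw [h0, h1, h2, h3]
  ring

theorem weight_zero (N : ℕ) : weight (0 : Bits N) = 0 := by
  simp [weight]

/-- A weighted sum over error patterns is bounded below by splitting off the trivial error. -/
theorem le_sum_weight_pow_mul_pow_mul {N : ℕ} {p : ℝ} (hp₀ : 0 ≤ p) (hp₁ : p ≤ 1)
    {T : Bits N → ℝ} {b : ℝ} (hT : ∀ x, b ≤ T x) :
    b + (1 - p) ^ N * (T 0 - b) ≤
      ∑ x : Bits N, p ^ weight x * (1 - p) ^ (N - weight x) * T x := by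
  have hb : ∑ x : Bits N, p ^ weight x * (1 - p) ^ (N - weight x) * T x =
      b + ∑ x : Bits N, p ^ weight x * (1 - p) ^ (N - weight x) * (T x - b) := by
    simp only [mul_sub, Finset.sum_sub_distrib, ← Finset.sum_mul, sum_weight_pow_mul_pow]
    ring
  have h1 : 0 ≤ 1 - p := sub_nonneg.2 hp₁
  have h0 := Finset.single_le_sum (s := Finset.univ)
    (f := fun x : Bits N => p ^ weight x * (1 - p) ^ (N - weight x) * (T x - b))
    (fun x _ => mul_nonneg (by positivity) (sub_nonneg.2 (hT x))) (Finset.mem_univ 0)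
  simp only [weight_zero, pow_zero, one_mul, Nat.sub_zero] at h0
  rw [hb]
  linarith

theorem ketbra_posSemidef {N : ℕ} (ψ : Bits N → ℂ) : (ketbra ψ).PosSemidef :=
  Matrix.posSemidef_vecMulVec_self_star ψ

/-- A lower bound on the quantum Fisher information of a dephased real state, in terms of the
variance of the generator and the probability `(1 - p) ^ N` that no error occurs. -/
theorem two_mul_variance_mul_sq_le_qfi_dephase {N : ℕ} {p : ℝ} (hp₀ : 0 ≤ p) (hp₁ : p ≤ 1)
    (c : ℝ) (f h : Bits N → ℝ) (hf : ∑ y, f y ^ 2 = 1) (hfh : ∑ y, f y ^ 2 * h y = 0)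
    (hV : 0 < ∑ y, f y ^ 2 * h y ^ 2) (hq : 2 ≤ 3 * (1 - p) ^ N)
    (hρ : (dephase p (ketbra fun y => (f y : ℂ))).IsHermitian) :
    2 * (∑ y, f y ^ 2 * h y ^ 2) * (3 * (1 - p) ^ N - 2) ^ 2 ≤
      qfi (dephase p (ketbra fun y => (f y : ℂ)))
        (Matrix.diagonal fun y => ((h y + c : ℝ) : ℂ)) hρ * (2 - (1 - p) ^ N) := by
  set V := ∑ y, f y ^ 2 * h y ^ 2 with hVdef
  set q := (1 - p) ^ N with hqdef
  have hpos := dephase_posSemidef hp₀ hp₁ (ketbra_posSemidef fun y => (f y : ℂ))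
  have key := two_mul_norm_commutator_sq_le_qfi_mul hρ hpos
    (Matrix.diagonal fun y => ((h y + c : ℝ) : ℂ)) (fun y => (f y : ℂ))
    (fun y => ((f y * h y : ℝ) : ℂ))
  rw [commutator_dephase_ketbra, star_dotProduct_dephase_ketbra_mulVec,
    star_dotProduct_dephase_ketbra_mulVec, star_dotProduct_ofReal, star_dotProduct_ofReal,
    Complex.norm_real, Real.norm_eq_abs, sq_abs, Complex.ofReal_re, Complex.ofReal_re,
    Complex.ofReal_re, Complex.ofReal_re] at key
  have hbb : ∑ y, f y * h y * (f y * h y) = V := Finset.sum_congr rfl fun y _ => by ring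
  have haa : ∑ y, f y * f y = 1 := by
    rw [← hf]
    exact Finset.sum_congr rfl fun y _ => by ring
  have hA : ∀ x : Bits N, |∑ y, zSign x y * f y ^ 2| ≤ 1 := fun x =>
    (abs_sum_zSign_mul_le x fun y => sq_nonneg (f y)).trans_eq hf
  have hB : ∀ x : Bits N, |∑ y, zSign x y * (f y ^ 2 * h y ^ 2)| ≤ V := fun x =>
    abs_sum_zSign_mul_le x fun y => by positivity
  have hC : ∀ x : Bits N, (∑ y, zSign x y * (f y ^ 2 * h y)) ^ 2 ≤ V := fun x => by
    have := sq_sum_zSign_mul_le x f h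
    rwa [hf, one_mul] at this
  set T : Bits N → ℝ := fun x => (∑ y, zSign x y * f y ^ 2) *
    (∑ y, zSign x y * (f y ^ 2 * h y ^ 2)) - (∑ y, zSign x y * (f y ^ 2 * h y)) ^ 2 with hT
  set E : Bits N → ℝ := fun x => -((∑ y, zSign x y * f y ^ 2) ^ 2 * V +
    (∑ y, zSign x y * (f y ^ 2 * h y)) ^ 2) with hE
  have hT0 : T 0 = V := by simp [hT, zSign_zero, hf, hfh, hVdef]
  have hE0 : E 0 = -V := by simp [hE, zSign_zero, hf, hfh]
  -- Worst case `-2V` against `T 0 = V`: the average of `T` is at least `V * (3 * q - 2)`.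
  have hTlb : ∀ x, -(2 * V) ≤ T x := fun x => by
    have h1 := mul_le_mul (hA x) (hB x) (abs_nonneg _) zero_le_one
    rw [← abs_mul] at h1
    have h2 := (abs_le.1 h1).1
    have h3 := hC x
    simp only [hT]
    linarith
  -- `E` is the negated denominator, so the same splitting lemma gives an upper bound `V * (2 - q)`.
  have hElb : ∀ x, -(2 * V) ≤ E x := fun x => by
    have h1 := mul_le_mul_of_nonneg_right ((sq_le_one_iff_abs_le_one _).2 (hA x)) hV.le
    have h3 := hC x
    simp only [hE]
    linarith
  have hTsum := le_sum_weight_pow_mul_pow_mul hp₀ hp₁ hTlb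
  have hEsum := le_sum_weight_pow_mul_pow_mul hp₀ hp₁ hElb
  rw [hT0] at hTsum
  rw [hE0] at hEsum
  have hden : (∑ x : Bits N, p ^ weight x * (1 - p) ^ (N - weight x) *
        ((∑ y, zSign x y * (f y * f y)) * ∑ y, zSign x y * (f y * f y))) * V +
      1 * ∑ x : Bits N, p ^ weight x * (1 - p) ^ (N - weight x) *
        ((∑ y, zSign x y * (f y * h y * f y)) * ∑ y, zSign x y * (f y * (f y * h y))) =
      -∑ x : Bits N, p ^ weight x * (1 - p) ^ (N - weight x) * E x := by
    rw [one_mul, Finset.sum_mul, ← Finset.sum_add_distrib, ← Finset.sum_neg_distrib]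
    refine Finset.sum_congr rfl fun x _ => ?_
    have h0 : ∑ y, zSign x y * (f y * f y) = ∑ y, zSign x y * f y ^ 2 :=
      Finset.sum_congr rfl fun y _ => by ring
    have h1 : ∑ y, zSign x y * (f y * (f y * h y)) = ∑ y, zSign x y * (f y ^ 2 * h y) :=
      Finset.sum_congr rfl fun y _ => by ring
    have h2 : ∑ y, zSign x y * (f y * h y * f y) = ∑ y, zSign x y * (f y ^ 2 * h y) :=
      Finset.sum_congr rfl fun y _ => by ring
    simp only [hE, h0, h1, h2]
    ring
  rw [hbb, haa, hden] at key
  set Q := qfi (dephase p (ketbra fun y => (f y : ℂ)))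
    (Matrix.diagonal fun y => ((h y + c : ℝ) : ℂ)) hρ with hQ
  have hQ0 : 0 ≤ Q := qfi_nonneg hρ hpos _
  -- Squaring preserves the inequality because `hq` makes `3 * q - 2` nonnegative.
  have h1 : (V * (3 * q - 2)) ^ 2 ≤
      (∑ x : Bits N, p ^ weight x * (1 - p) ^ (N - weight x) * T x) ^ 2 :=
    pow_le_pow_left₀ (mul_nonneg hV.le (by linarith)) (by linarith) 2
  have h2 : Q * (-∑ x : Bits N, p ^ weight x * (1 - p) ^ (N - weight x) * E x) ≤
      Q * (V * (2 - q)) := mul_le_mul_of_nonneg_left (by linarith) hQ0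
  refine le_of_mul_le_mul_right ?_ hV
  calc 2 * V * (3 * q - 2) ^ 2 * V = 2 * (V * (3 * q - 2)) ^ 2 := by ring
    _ ≤ Q * (V * (2 - q)) := by linarith
    _ = Q * (2 - q) * V := by ring

/-! ### The dephased gnu probe. -/

/-- The deviation of the generator `H` from its mean `gn` in the probe state. -/
noncomputable def generatorDeviation (g n : ℕ) (y : Bits (g * n * 2)) : ℝ :=
  (g : ℝ) * n - 2 * weight y

theorem sum_gnuAmplitude_sq {g : ℕ} (n : ℕ) (hg : 1 ≤ g) :
    ∑ y, gnuAmplitude g n 2 y ^ 2 = 1 := by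
  have h := sum_gnuAmplitude_sq_mul (u := 2) n hg one_le_two fun _ => 1
  simpa only [mul_one, sum_half_binomial] using h

theorem sum_gnuAmplitude_sq_mul_deviation {g : ℕ} (n : ℕ) (hg : 1 ≤ g) :
    ∑ y, gnuAmplitude g n 2 y ^ 2 * generatorDeviation g n y = 0 := by
  have h := sum_gnuAmplitude_sq_mul (u := 2) n hg one_le_two fun w => (g : ℝ) * n - 2 * w
  refine h.trans ?_
  have h1 := sum_half_binomial n
  have h2 := sum_half_binomial_mul n
  calc _ = (g : ℝ) * n * (∑ j ∈ Finset.range (n + 1), (2 ^ n)⁻¹ * (n.choose j : ℝ)) -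
        2 * g * ∑ j ∈ Finset.range (n + 1), (2 ^ n)⁻¹ * (n.choose j : ℝ) * j := by
        rw [Finset.mul_sum, Finset.mul_sum, ← Finset.sum_sub_distrib]
        refine Finset.sum_congr rfl fun j _ => ?_
        push_cast
        ring
    _ = 0 := by
        rw [h1, h2]
        ring

theorem sum_gnuAmplitude_sq_mul_deviation_sq {g : ℕ} (n : ℕ) (hg : 1 ≤ g) :
    ∑ y, gnuAmplitude g n 2 y ^ 2 * generatorDeviation g n y ^ 2 = (g : ℝ) ^ 2 * n := by
  have h := sum_gnuAmplitude_sq_mul (u := 2) n hg one_le_two fun w => ((g : ℝ) * n - 2 * w) ^ 2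
  refine h.trans ?_
  calc _ = 4 * (g : ℝ) ^ 2 * ∑ j ∈ Finset.range (n + 1),
        (2 ^ n)⁻¹ * (n.choose j : ℝ) * ((n : ℝ) / 2 - j) ^ 2 := by
        rw [Finset.mul_sum]
        refine Finset.sum_congr rfl fun j _ => ?_
        push_cast
        ring
    _ = (g : ℝ) ^ 2 * n := by
        rw [sum_half_binomial_mul_sq]
        ring

theorem dephasedQFI_nonneg {p : ℝ} (hp₀ : 0 ≤ p) (hp₁ : p ≤ 1) (g n : ℕ) :
    0 ≤ dephasedQFI g n p :=
  qfi_nonneg _ (dephase_posSemidef hp₀ hp₁ (ketbra_posSemidef _)) _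

/-- Needed because `qfi` takes a Hermiticity proof depending on `ρ`, which obstructs direct
rewriting. -/
theorem qfi_congr {ι : Type*} [Fintype ι] [DecidableEq ι] {ρ ρ' H H' : Matrix ι ι ℂ}
    (h : ρ = ρ') (h' : H = H') (hρ : ρ.IsHermitian) (hρ' : ρ'.IsHermitian) :
    qfi ρ H hρ = qfi ρ' H' hρ' := by
  subst h h'
  rfl

/-- A non-asymptotic lower bound on the quantum Fisher information of the dephased probe, when the
expected number of errors is at most `1 / 3`. -/
theorem le_dephasedQFI {g n : ℕ} (hg : 1 ≤ g) (hn : 1 ≤ n) {t : ℝ} (ht₀ : 0 ≤ t)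
    (ht₁ : 3 * t ≤ 1) :
    2 * ((g : ℝ) ^ 2 * n) * (1 - 7 * t) ≤ dephasedQFI g n (t / (2 * (g : ℝ) * (n : ℝ))) := by
  have hg' : (1 : ℝ) ≤ g := by exact_mod_cast hg
  have hn' : (1 : ℝ) ≤ n := by exact_mod_cast hn
  have hN : (1 : ℝ) ≤ 2 * (g : ℝ) * (n : ℝ) := by nlinarith
  set p := t / (2 * (g : ℝ) * (n : ℝ)) with hp
  have hp₀ : 0 ≤ p := by positivity
  have hp₁ : p ≤ 1 := by
    rw [hp, div_le_one (by linarith)]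
    linarith
  have hq : 1 - t ≤ (1 - p) ^ (g * n * 2) := by
    -- Bernoulli's inequality, with `N * p = t`.
    have h := one_add_mul_le_pow (a := -p) (by linarith) (g * n * 2)
    have h' : ((g * n * 2 : ℕ) : ℝ) * p = t := by
      rw [hp]
      push_cast
      field_simp
    rw [← sub_eq_add_neg] at h
    linarith
  have hV := sum_gnuAmplitude_sq_mul_deviation_sq n hg
  have hVpos : 0 < (g : ℝ) ^ 2 * n := by positivity
  have hρ : (dephase p (ketbra fun y => (gnuAmplitude g n 2 y : ℂ))).IsHermitian :=
    dephase_isHermitian p (ketbra_posSemidef _).isHermitian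
  have key := two_mul_variance_mul_sq_le_qfi_dephase hp₀ hp₁ ((g : ℝ) * n) (gnuAmplitude g n 2)
    (generatorDeviation g n) (sum_gnuAmplitude_sq n hg) (sum_gnuAmplitude_sq_mul_deviation n hg)
    (by rwa [hV]) (by linarith) hρ
  have hQ : qfi (dephase p (ketbra fun y => (gnuAmplitude g n 2 y : ℂ)))
      (Matrix.diagonal fun y => ((generatorDeviation g n y + (g : ℝ) * n : ℝ) : ℂ)) hρ =
      dephasedQFI g n p := by
    refine qfi_congr ?_ ?_ _ _
    · rw [dephasedProbe, gnuProbe_eq_ofReal]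
    · rw [generator_eq_diagonal]
      congr 1
      funext y
      rw [generatorDeviation]
      push_cast
      ring
  rw [hQ, hV] at key
  have hQ0 := dephasedQFI_nonneg hp₀ hp₁ g n
  set q := (1 - p) ^ (g * n * 2) with hqdef
  have h1 : (1 - 3 * t) ^ 2 ≤ (3 * q - 2) ^ 2 := pow_le_pow_left₀ (by linarith) (by linarith) 2
  have h2 : dephasedQFI g n p * (2 - q) ≤ dephasedQFI g n p * (1 + t) :=
    mul_le_mul_of_nonneg_left (by linarith) hQ0
  have h3 : (1 - 7 * t) * (1 + t) ≤ (1 - 3 * t) ^ 2 := by nlinarith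
  refine le_of_mul_le_mul_right ?_ (by linarith : 0 < 1 + t)
  calc 2 * ((g : ℝ) ^ 2 * n) * (1 - 7 * t) * (1 + t)
      = 2 * ((g : ℝ) ^ 2 * n) * ((1 - 7 * t) * (1 + t)) := by ring
    _ ≤ 2 * ((g : ℝ) ^ 2 * n) * (3 * q - 2) ^ 2 :=
        mul_le_mul_of_nonneg_left (h3.trans h1) (by positivity)
    _ ≤ dephasedQFI g n p * (1 + t) := key.trans h2

end GnuMetrology

/-! ### The asymptotic statements. -/

theorem mainTheorem7 (n : ℕ) (hn : 1 ≤ n) :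
    (∀ t : ℝ, 0 ≤ t →
      ((Real.exp (-2 * t) / (2 * (n : ℝ)) - 2 * t * Real.exp 1 : ℝ) : EReal) ≤
        Filter.liminf (fun g : ℕ =>
          ((GnuMetrology.dephasedQFI g n (t / (2 * (g : ℝ) * (n : ℝ))) /
            (2 * (g : ℝ) * (n : ℝ)) ^ 2 : ℝ) : EReal)) Filter.atTop) ∧
    (∃ t₀ : ℝ, 0 < t₀ ∧ ∃ c : ℝ, 0 < c ∧ ∀ t : ℝ, 0 ≤ t → t ≤ t₀ →
      ∀ᶠ g : ℕ in Filter.atTop,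
        c * (2 * (g : ℝ) * (n : ℝ)) ^ 2 ≤
          GnuMetrology.dephasedQFI g n (t / (2 * (g : ℝ) * (n : ℝ)))) := by
  have hn' : (1 : ℝ) ≤ n := by exact_mod_cast hn
  -- `t ≤ 1 / 14` makes `1 - 7 * t ≥ 1 / 2`, and then `g ^ 2 * n = N ^ 2 / (4 * n)`.
  refine ⟨fun t ht => ?_, 1 / 14, by norm_num, 1 / (4 * n), by positivity, fun t ht₀ ht₁ => ?_⟩
  · have hexp : Real.exp (-2 * t) ≤ 1 := Real.exp_le_one_iff.2 (by linarith)
    have he : (2.7 : ℝ) ≤ Real.exp 1 := by linarith [Real.exp_one_gt_d9]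
    have hte : 2.7 * t ≤ t * Real.exp 1 := by nlinarith
    have hhalf : Real.exp (-2 * t) / (2 * (n : ℝ)) ≤ 1 / (2 * n) := by gcongr
    refine Filter.le_liminf_of_le (by isBoundedDefault) ?_
    -- `g ≥ t` ensures `p ≤ 1`, which positivity of the state requires when `t` is large.
    filter_upwards [Filter.eventually_ge_atTop (max 1 ⌈t⌉₊)] with g hg
    have hg1 : 1 ≤ g := (le_max_left _ _).trans hg
    have hg' : (1 : ℝ) ≤ g := by exact_mod_cast hg1
    rw [EReal.coe_le_coe_iff]
    by_cases h3 : 3 * t ≤ 1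
    · have h := GnuMetrology.le_dephasedQFI hg1 hn ht h3
      rw [le_div_iff₀ (by positivity)]
      refine le_trans ?_ h
      -- The loss `7 * t / (2 * n)` is at most `3.5 * t`, below `2 * t * e ≥ 5.4 * t`.
      have hbound : Real.exp (-2 * t) / (2 * (n : ℝ)) - 2 * t * Real.exp 1 ≤
          (1 - 7 * t) / (2 * n) := by
        have h7 : 7 * t / (2 * n) ≤ 7 * t / 2 := by
          apply div_le_div_of_nonneg_left (by positivity) (by norm_num) (by linarith)
        rw [sub_div]
        linarith
      calc _ ≤ (1 - 7 * t) / (2 * n) * (2 * (g : ℝ) * n) ^ 2 := by gcongr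
        _ = 2 * ((g : ℝ) ^ 2 * n) * (1 - 7 * t) := by
          field_simp
    -- For `t > 1 / 3` the left side is at most `1 / 2 - 5.4 / 3 < 0`, so nonnegativity of the
    -- Fisher information suffices.
    · have hN : t ≤ 2 * (g : ℝ) * n := by
        have h1 : t ≤ g := (Nat.le_ceil t).trans (by exact_mod_cast (le_max_right _ _).trans hg)
        nlinarith
      have hQ := GnuMetrology.dephasedQFI_nonneg (p := t / (2 * (g : ℝ) * n)) (by positivity)
        ((div_le_one (by positivity)).2 hN) g n
      refine le_trans ?_ (div_nonneg hQ (by positivity))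
      have h1 : 1 / (2 * (n : ℝ)) ≤ 1 / 2 :=
        div_le_div_of_nonneg_left zero_le_one (by norm_num) (by linarith)
      linarith
  · filter_upwards [Filter.eventually_ge_atTop 1] with g hg
    have h := GnuMetrology.le_dephasedQFI hg hn ht₀ (by linarith : 3 * t ≤ 1)
    refine le_trans ?_ h
    have hVpos : 0 ≤ (g : ℝ) ^ 2 * n := by positivity
    calc 1 / (4 * (n : ℝ)) * (2 * (g : ℝ) * n) ^ 2 = 2 * ((g : ℝ) ^ 2 * n) * (1 / 2) := by
          field_simp
          ring
      _ ≤ 2 * ((g : ℝ) ^ 2 * n) * (1 - 7 * t) :=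
          mul_le_mul_of_nonneg_left (by linarith) (by positivity)
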